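/- For a finite simple graph $G$, let $\mu(G)$ be the average size of the independent vertex sets of $G$ (the empty set included), i.e. $\mu(G)=\frac{\sum_k k\, i(G,k)}{\sum_k i(G,k)}$, where $i(G,k)$ is the number of independent vertex sets of $G$ of size $k$. Let $P_n$ be the path with $n$ vertices, and put $a=\frac{5-\sqrt5}{10}$ and $b=\frac{79\sqrt5-165}{70}$. Theorem. Every tree $T$ with $n$ vertices that is not a path satisfies $$\mu(T)\ \ge\ a n+b .$$ Consequently, $P_n$ is the unique minimiser of $\mu$ among all trees with $n$ vertices: every tree $T$ with $n$ vertices satisfies $\mu(T)\ge\mu(P_n)$, with equality if and only if $T$ is isomorphic to $P_n$. -/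

import Mathlib

open scoped Classical in
/-- The family of all independent vertex sets of a finite graph (the empty set included). -/
noncomputable def indepSets {V : Type*} [Fintype V] (G : SimpleGraph V) : Finset (Finset V) :=
  Finset.univ.filter fun S => G.IsIndepSet (S : Set V)

/-- The total number `I(G)` of independent sets of `G`. -/
noncomputable def numIndepSets {V : Type*} [Fintype V] (G : SimpleGraph V) : ℕ :=
  (indepSets G).card

/-- The total size `T(G)` of all independent sets of `G`. -/
noncomputable def totalIndepSize {V : Type*} [Fintype V] (G : SimpleGraph V) : ℕ :=
  ∑ S ∈ indepSets G, S.card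

/-- The average size `μ(G) = T(G) / I(G)` of the independent sets of `G`. The denominator is never
zero, because the empty set is independent. -/
noncomputable def avgIndepSize {V : Type*} [Fintype V] (G : SimpleGraph V) : ℝ :=
  (totalIndepSize G : ℝ) / (numIndepSets G : ℝ)

namespace IndepTree

open Polynomial
open scoped Classical

/-! Write a for `slope` and b = 23/7 - 79a/7 ≈ 0.1664 for the intercept. The quantity to bound is
the `excess`, average size minus a times the number of vertices; it is additive over parts with no
edges between them.

A tree is a path unless some vertex v has at least three neighbours. Condition on whether v lies in
a uniformly random independent set, which has probability q. The excess becomes -a + q plus one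
contribution per branch K at v, a mixture with weights 1 - q and q of terms for K and for K without
its root w (`excess_eq_sum`). Moreover q / (1 - q) is the product of the ratios p = num(K - w) /
num(K), so lower bounds on the p give a lower bound on q.

Branches are smaller trees, which allows an induction: every tree except the single edge has excess
at least 5/4 - 4a ≈ 0.1444, the value of the path on four vertices. A single edge has only 2/3 - 2a
≈ 0.1139, but as a branch it has p = 2/3 instead of the general bound p ≥ 1/2, and the larger q pays
for the loss. `branch_bound` and `branch_sum_bound` turn this into excess at least b at a branching
vertex. Since b > 5/4 - 4a, the induction closes (`lowerBoundBelow`), paths being settled by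
Fibonacci-type recurrences. The same recurrences put the excess of a path on at least four vertices
strictly below b (`pathExcess_upper`). -/

variable {V : Type*} {G : SimpleGraph V}

/-! ### Independence polynomials, counts and averages on vertex subsets -/

/-- The independence polynomial of the subgraph of `G` induced by `U`. -/
noncomputable def indepPoly (G : SimpleGraph V) (U : Finset V) : ℝ[X] :=
  ∑ S ∈ U.powerset.filter (fun S : Finset V => G.IsIndepSet (S : Set V)), X ^ S.card

/-- There are no edges of `G` between `A` and `B`. -/
def Sep (G : SimpleGraph V) (A B : Finset V) : Prop := ∀ x ∈ A, ∀ y ∈ B, ¬ G.Adj x y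

/-- The vertices of `U` that are neither `v` nor adjacent to `v`. -/
noncomputable def remote (G : SimpleGraph V) (U : Finset V) (v : V) : Finset V :=
  (U.erase v).filter (fun x => ¬ G.Adj v x)

theorem indepPoly_empty : indepPoly G ∅ = 1 := by
  simp [indepPoly, Finset.filter_singleton]

/-- Split by whether the independent set contains v; deleting v from those that do leaves an
independent subset of `remote G U v`. -/
theorem indepPoly_recurrence {U : Finset V} {v : V} (hv : v ∈ U) :
    indepPoly G U = indepPoly G (U.erase v) + X * indepPoly G (remote G U v) := by
  unfold indepPoly
  rw [← Finset.sum_filter_add_sum_filter_not _ (fun S => v ∉ S)]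
  congr 1
  · apply Finset.sum_congr _ (fun _ _ => rfl)
    ext S
    simp only [Finset.mem_filter, Finset.mem_powerset, Finset.subset_erase]
    tauto
  · rw [Finset.mul_sum]
    refine Finset.sum_nbij' (fun S => S.erase v) (fun S => insert v S) ?_ ?_ ?_ ?_ ?_
    · intro S hS
      simp only [Finset.mem_filter, Finset.mem_powerset, not_not] at hS ⊢
      obtain ⟨⟨hSU, hI⟩, hvS⟩ := hS
      refine ⟨fun x hx => ?_, hI.mono (by simp)⟩
      have hx' := Finset.mem_erase.1 hx
      simp only [remote, Finset.mem_filter, Finset.mem_erase]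
      exact ⟨⟨hx'.1, hSU hx'.2⟩, hI hvS hx'.2 (Ne.symm hx'.1)⟩
    · intro S hS
      simp only [Finset.mem_filter, Finset.mem_powerset, not_not] at hS ⊢
      obtain ⟨hSU, hI⟩ := hS
      have hS' : ∀ x ∈ S, (x ≠ v ∧ x ∈ U) ∧ ¬ G.Adj v x := fun x hx => by
        simpa [remote] using hSU hx
      refine ⟨⟨fun x hx => ?_, ?_⟩, Finset.mem_insert_self _ _⟩
      · rcases Finset.mem_insert.1 hx with rfl | hx
        exacts [hv, (hS' x hx).1.2]
      · intro x hx y hy hxy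
        rcases Finset.mem_insert.1 (Finset.mem_coe.1 hx) with hx | hx <;>
          rcases Finset.mem_insert.1 (Finset.mem_coe.1 hy) with hy | hy
        · exact absurd (hx.trans hy.symm) hxy
        · exact hx ▸ (hS' y hy).2
        · exact fun h => (hS' x hx).2 (hy ▸ h.symm)
        · exact hI hx hy hxy
    · intro S hS
      simp only [Finset.mem_filter, not_not] at hS
      exact Finset.insert_erase hS.2
    · intro S hS
      simp only [Finset.mem_filter, Finset.mem_powerset] at hS
      refine Finset.erase_insert fun h => ?_
      simpa [remote] using hS.1 h
    · intro S hS
      simp only [Finset.mem_filter, not_not] at hS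
      rw [← pow_succ', Finset.card_erase_add_one hS.2]

theorem indepPoly_union {A B : Finset V} (hd : Disjoint A B) (hs : Sep G A B) :
    indepPoly G (A ∪ B) = indepPoly G A * indepPoly G B := by
  unfold indepPoly
  rw [Finset.sum_mul_sum, ← Finset.sum_product']
  refine Finset.sum_nbij' (fun S => (S ∩ A, S ∩ B)) (fun p => p.1 ∪ p.2) ?_ ?_ ?_ ?_ ?_
  · intro S hS
    simp only [Finset.mem_filter, Finset.mem_powerset, Finset.mem_product] at hS ⊢
    exact ⟨⟨Finset.inter_subset_right, hS.2.mono (by simp)⟩,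
      ⟨Finset.inter_subset_right, hS.2.mono (by simp)⟩⟩
  · rintro ⟨S, S'⟩ h
    simp only [Finset.mem_filter, Finset.mem_powerset, Finset.mem_product] at h ⊢
    obtain ⟨⟨h1, h2⟩, h3, h4⟩ := h
    refine ⟨Finset.union_subset_union h1 h3, ?_⟩
    intro x hx y hy hxy
    rcases Finset.mem_union.1 (Finset.mem_coe.1 hx) with hx | hx <;>
      rcases Finset.mem_union.1 (Finset.mem_coe.1 hy) with hy | hy
    · exact h2 hx hy hxy
    · exact hs x (h1 hx) y (h3 hy)
    · exact fun h => hs y (h1 hy) x (h3 hx) h.symm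
    · exact h4 hx hy hxy
  · intro S hS
    simp only [Finset.mem_filter, Finset.mem_powerset] at hS
    rw [← Finset.inter_union_distrib_left, Finset.inter_eq_left.2 hS.1]
  · rintro ⟨S, S'⟩ h
    simp only [Finset.mem_filter, Finset.mem_powerset, Finset.mem_product] at h
    have e1 : ∀ x ∈ S, x ∉ B := fun x hx => Finset.disjoint_left.1 hd (h.1.1 hx)
    have e2 : ∀ x ∈ S', x ∉ A := fun x hx => Finset.disjoint_right.1 hd (h.2.1 hx)
    have e3 := h.1.1
    have e4 := h.2.1
    ext x
    · simp only [Finset.mem_inter, Finset.mem_union]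
      have := e2 x; have := @e3 x; tauto
    · simp only [Finset.mem_inter, Finset.mem_union]
      have := e1 x; have := @e4 x; tauto
  · intro S hS
    simp only [Finset.mem_filter, Finset.mem_powerset] at hS
    rw [← pow_add, ← Finset.card_union_of_disjoint, ← Finset.inter_union_distrib_left,
      Finset.inter_eq_left.2 hS.1]
    exact hd.mono Finset.inter_subset_right Finset.inter_subset_right

/-- The number of independent sets contained in `U`. -/
noncomputable def num (G : SimpleGraph V) (U : Finset V) : ℝ := (indepPoly G U).eval 1

/-- The total size of the independent sets contained in `U`. -/
noncomputable def tot (G : SimpleGraph V) (U : Finset V) : ℝ := (indepPoly G U).derivative.eval 1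

/-- The average size of the independent sets contained in `U`. -/
noncomputable def avg (G : SimpleGraph V) (U : Finset V) : ℝ := tot G U / num G U

theorem num_pos (U : Finset V) : 0 < num G U := by
  simp only [num, indepPoly, eval_finsetSum, eval_pow, eval_X, one_pow, Finset.sum_const,
    nsmul_eq_mul, mul_one, Nat.cast_pos, Finset.card_pos]
  exact ⟨∅, by simp⟩

theorem tot_eq_avg_mul (U : Finset V) : tot G U = avg G U * num G U := by
  rw [avg, div_mul_cancel₀ _ (num_pos U).ne']

theorem avgIndepSize_eq [Fintype V] : avgIndepSize G = avg G Finset.univ := by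
  rw [avgIndepSize, avg]
  congr 1
  · simp [totalIndepSize, indepSets, tot, indepPoly, derivative_X_pow, eval_finsetSum]
  · simp [numIndepSets, indepSets, num, indepPoly, eval_finsetSum]

theorem num_empty : num G ∅ = 1 := by simp [num, indepPoly_empty]
theorem tot_empty : tot G ∅ = 0 := by simp [tot, indepPoly_empty]
theorem avg_empty : avg G ∅ = 0 := by simp [avg, tot_empty]

theorem num_recurrence {U : Finset V} {v : V} (hv : v ∈ U) :
    num G U = num G (U.erase v) + num G (remote G U v) := by
  simp [num, indepPoly_recurrence hv]

theorem tot_recurrence {U : Finset V} {v : V} (hv : v ∈ U) :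
    tot G U = tot G (U.erase v) + tot G (remote G U v) + num G (remote G U v) := by
  simp [num, tot, indepPoly_recurrence hv]; ring

theorem num_union {A B : Finset V} (hd : Disjoint A B) (hs : Sep G A B) :
    num G (A ∪ B) = num G A * num G B := by
  simp [num, indepPoly_union hd hs]

theorem avg_union {A B : Finset V} (hd : Disjoint A B) (hs : Sep G A B) :
    avg G (A ∪ B) = avg G A + avg G B := by
  have hA := num_pos (G := G) A
  have hB := num_pos (G := G) B
  rw [avg, avg, avg, num_union hd hs, div_add_div _ _ hA.ne' hB.ne']
  simp [tot, num, indepPoly_union hd hs]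

theorem num_biUnion {ι : Type*} (D : Finset ι) (K : ι → Finset V)
    (hK : ∀ i ∈ D, ∀ j ∈ D, i ≠ j → Disjoint (K i) (K j) ∧ Sep G (K i) (K j)) :
    num G (D.biUnion K) = ∏ i ∈ D, num G (K i) ∧
      avg G (D.biUnion K) = ∑ i ∈ D, avg G (K i) := by
  induction D using Finset.induction_on with
  | empty => simp [num_empty, avg_empty]
  | insert i D hi ih =>
    have ih := ih fun j hj k hk => hK j (Finset.mem_insert_of_mem hj) k (Finset.mem_insert_of_mem hk)
    have key : ∀ j ∈ D, Disjoint (K i) (K j) ∧ Sep G (K i) (K j) := fun j hj =>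
      hK i (Finset.mem_insert_self _ _) j (Finset.mem_insert_of_mem hj) (fun h => hi (h ▸ hj))
    have hd : Disjoint (K i) (D.biUnion K) :=
      (Finset.disjoint_biUnion_right _ _ _).2 fun j hj => (key j hj).1
    have hs : Sep G (K i) (D.biUnion K) := fun x hx y hy => by
      obtain ⟨j, hj, hy⟩ := Finset.mem_biUnion.1 hy
      exact (key j hj).2 x hx y hy
    rw [Finset.biUnion_insert, Finset.prod_insert hi, Finset.sum_insert hi, num_union hd hs,
      avg_union hd hs, ih.1, ih.2]
    exact ⟨rfl, rfl⟩

theorem num_mono {A B : Finset V} (h : A ⊆ B) : num G A ≤ num G B := by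
  simp only [num, indepPoly, eval_finsetSum, eval_pow, eval_X, one_pow, Finset.sum_const,
    nsmul_eq_mul, mul_one, Nat.cast_le]
  exact Finset.card_le_card (Finset.filter_subset_filter _ (Finset.powerset_mono.2 h))

/-! ### Connected sets, components and branches at a vertex -/

/-- The set `U` is nonempty and induces a connected subgraph of `G`. -/
def ConnSet (G : SimpleGraph V) (U : Finset V) : Prop :=
  U.Nonempty ∧ ∀ K ⊆ U, K.Nonempty → Sep G K (U \ K) → K = U

/-- The neighbours of `v` in `U`. -/
noncomputable def nbrs (G : SimpleGraph V) (U : Finset V) (v : V) : Finset V :=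
  U.filter (G.Adj v)

/-- No vertex has two neighbours in a connected set that does not contain it. -/
def NoCycle (G : SimpleGraph V) : Prop :=
  ∀ (K : Finset V) (v w w' : V), ConnSet G K → v ∉ K → w ∈ K → w' ∈ K → G.Adj v w → G.Adj v w' →
    w = w'

theorem mem_nbrs {U : Finset V} {v w : V} : w ∈ nbrs G U v ↔ w ∈ U ∧ G.Adj v w :=
  Finset.mem_filter

/-- The connected component of `x` in the subgraph induced by `W`. -/
noncomputable def comp (G : SimpleGraph V) (W : Finset V) (x : V) : Finset V :=
  W.filter fun y => ∀ K ⊆ W, Sep G K (W \ K) → x ∈ K → y ∈ K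

theorem comp_subset {W : Finset V} {x : V} : comp G W x ⊆ W := Finset.filter_subset _ _

theorem mem_comp_self {W : Finset V} {x : V} (hx : x ∈ W) : x ∈ comp G W x :=
  Finset.mem_filter.2 ⟨hx, fun _ _ _ h => h⟩

theorem comp_subset_of_sep {W K : Finset V} {x : V} (hK : K ⊆ W) (hs : Sep G K (W \ K))
    (hx : x ∈ K) : comp G W x ⊆ K := fun _ hy => (Finset.mem_filter.1 hy).2 K hK hs hx

theorem Sep.symm {A B : Finset V} (h : Sep G A B) : Sep G B A :=
  fun x hx y hy hxy => h y hy x hx hxy.symm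

theorem sep_comp {W : Finset V} {x : V} : Sep G (comp G W x) (W \ comp G W x) := by
  intro y hy z hz hyz
  rw [Finset.mem_sdiff] at hz
  refine hz.2 (Finset.mem_filter.2 ⟨hz.1, fun K hK hs hx => ?_⟩)
  by_contra hzK
  exact hs y (comp_subset_of_sep hK hs hx hy) z (Finset.mem_sdiff.2 ⟨hz.1, hzK⟩) hyz

theorem connSet_comp {W : Finset V} {x : V} (hx : x ∈ W) : ConnSet G (comp G W x) := by
  refine ⟨⟨x, mem_comp_self hx⟩, fun K hK hne hs => ?_⟩
  have hKW := hK.trans comp_subset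
  have h1 : Sep G K (W \ K) := by
    intro y hy z hz hyz
    rw [Finset.mem_sdiff] at hz
    by_cases hzc : z ∈ comp G W x
    · exact hs y hy z (Finset.mem_sdiff.2 ⟨hzc, hz.2⟩) hyz
    · exact sep_comp y (hK hy) z (Finset.mem_sdiff.2 ⟨hz.1, hzc⟩) hyz
  by_cases hxK : x ∈ K
  · exact hK.antisymm (comp_subset_of_sep hKW h1 hxK)
  -- If K misses x, its complement in W is a separated set containing x, hence contains the whole
  -- component and so K itself.
  · obtain ⟨y, hy⟩ := hne
    have h2 : Sep G (W \ K) (W \ (W \ K)) := by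
      rw [Finset.sdiff_sdiff_eq_self hKW]; exact h1.symm
    have := comp_subset_of_sep Finset.sdiff_subset h2 (Finset.mem_sdiff.2 ⟨hx, hxK⟩) (hK hy)
    exact absurd hy (Finset.mem_sdiff.1 this).2

theorem comp_eq_of_mem {W : Finset V} {x y : V} (hx : x ∈ W) (hy : y ∈ comp G W x) :
    comp G W y = comp G W x := by
  have h := comp_subset_of_sep comp_subset sep_comp hy
  refine (connSet_comp hx).2 _ h ⟨y, mem_comp_self (comp_subset hy)⟩ ?_
  exact fun a ha b hb => sep_comp a ha b (Finset.sdiff_subset_sdiff comp_subset subset_rfl hb)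

/-- A nonempty separated part of a connected set with a vertex removed meets the
neighbourhood of that vertex. -/
theorem exists_adj_of_sep {U K : Finset V} {v : V} (hU : ConnSet G U) (hv : v ∈ U)
    (hK : K ⊆ U.erase v) (hne : K.Nonempty) (hs : Sep G K (U.erase v \ K)) :
    ∃ w ∈ K, G.Adj v w := by
  by_contra! h
  have hvK : v ∉ K := fun h => absurd (hK h) (Finset.notMem_erase v U)
  refine hvK ((hU.2 K (hK.trans (Finset.erase_subset _ _)) hne ?_).symm ▸ hv)
  intro x hx y hy hxy
  rw [Finset.mem_sdiff] at hy
  by_cases hyv : y = v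
  · subst hyv; exact h x hx hxy.symm
  · exact hs x hx y (Finset.mem_sdiff.2 ⟨Finset.mem_erase.2 ⟨hyv, hy.1⟩, hy.2⟩) hxy

theorem exists_adj {U : Finset V} {v : V} (hU : ConnSet G U) (hv : v ∈ U)
    (h : (U.erase v).Nonempty) : (nbrs G U v).Nonempty := by
  obtain ⟨w, hw, hvw⟩ := exists_adj_of_sep hU hv subset_rfl h (by simp [Sep])
  exact ⟨w, mem_nbrs.2 ⟨Finset.mem_of_mem_erase hw, hvw⟩⟩

section Branch

variable {U : Finset V} {v : V}

theorem mem_erase_of_mem_nbrs {w : V} (hw : w ∈ nbrs G U v) : w ∈ U.erase v :=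
  Finset.mem_erase.2 ⟨(mem_nbrs.1 hw).2.ne', (mem_nbrs.1 hw).1⟩

theorem eq_of_mem_branch (hG : NoCycle G) {w w' : V} (hw : w ∈ nbrs G U v)
    (hw' : w' ∈ comp G (U.erase v) w) (ha : G.Adj v w') : w' = w :=
  hG _ v w' w (connSet_comp (mem_erase_of_mem_nbrs hw))
    (fun h => Finset.notMem_erase v U (comp_subset h)) hw'
    (mem_comp_self (mem_erase_of_mem_nbrs hw)) ha (mem_nbrs.1 hw).2

theorem biUnion_branch (hU : ConnSet G U) (hv : v ∈ U) :
    (nbrs G U v).biUnion (comp G (U.erase v)) = U.erase v := by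
  refine (Finset.biUnion_subset.2 fun _ _ => comp_subset).antisymm fun x hx => ?_
  obtain ⟨w, hw, hvw⟩ := exists_adj_of_sep hU hv comp_subset ⟨x, mem_comp_self hx⟩
    (sep_comp (G := G))
  refine Finset.mem_biUnion.2 ⟨w, mem_nbrs.2 ⟨Finset.mem_of_mem_erase (comp_subset hw), hvw⟩, ?_⟩
  rw [comp_eq_of_mem hx hw]
  exact mem_comp_self hx

theorem disjoint_sep_branch (hG : NoCycle G) {w w' : V} (hw : w ∈ nbrs G U v)
    (hw' : w' ∈ nbrs G U v) (hne : w ≠ w') :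
    Disjoint (comp G (U.erase v) w) (comp G (U.erase v) w') ∧
      Sep G (comp G (U.erase v) w) (comp G (U.erase v) w') := by
  have hd : Disjoint (comp G (U.erase v) w) (comp G (U.erase v) w') := by
    rw [Finset.disjoint_left]
    intro x hx hx'
    have e := (comp_eq_of_mem (mem_erase_of_mem_nbrs hw) hx).symm.trans
      (comp_eq_of_mem (mem_erase_of_mem_nbrs hw') hx')
    exact hne (eq_of_mem_branch hG hw' (e ▸ mem_comp_self (mem_erase_of_mem_nbrs hw))
      (mem_nbrs.1 hw).2)
  exact ⟨hd, fun x hx y hy => sep_comp x hx y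
    (Finset.mem_sdiff.2 ⟨comp_subset hy, Finset.disjoint_right.1 hd hy⟩)⟩

/-- Each branch contains exactly one neighbour of v, its root, so choosing v forbids precisely the
roots. -/
theorem biUnion_branch_erase (hG : NoCycle G) (hU : ConnSet G U) (hv : v ∈ U) :
    (nbrs G U v).biUnion (fun w => (comp G (U.erase v) w).erase w) = remote G U v := by
  ext x
  have hx : x ∈ U.erase v ↔ ∃ w ∈ nbrs G U v, x ∈ comp G (U.erase v) w := by
    rw [← Finset.mem_biUnion, biUnion_branch hU hv]
  rw [remote, Finset.mem_filter, hx, Finset.mem_biUnion]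
  simp only [Finset.mem_erase (α := V) (s := comp _ _ _)]
  constructor
  · rintro ⟨w, hw, hne, hx⟩
    exact ⟨⟨w, hw, hx⟩, fun h => hne (eq_of_mem_branch hG hw hx h)⟩
  · rintro ⟨⟨w, hw, hx⟩, hn⟩
    exact ⟨w, hw, fun h => hn (h ▸ (mem_nbrs.1 hw).2), hx⟩

theorem nbrs_subset_branch {w x : V} (hx : x ∈ comp G (U.erase v) w) :
    nbrs G U x ⊆ insert v (nbrs G (comp G (U.erase v) w) x) := by
  intro y hy
  rw [mem_nbrs] at hy
  rw [Finset.mem_insert, mem_nbrs]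
  by_cases h : y = v
  · exact Or.inl h
  · refine Or.inr ⟨?_, hy.2⟩
    by_contra hc
    exact sep_comp x hx y (Finset.mem_sdiff.2 ⟨Finset.mem_erase.2 ⟨h, hy.1⟩, hc⟩) hy.2

end Branch

/-- A connected set with at least two vertices has an end vertex different from a given one. -/
theorem exists_end_ne (hG : NoCycle G) (k : ℕ) : ∀ (U : Finset V) (v : V), U.card = k →
    ConnSet G U → v ∈ U → (U.erase v).Nonempty → ∃ u ∈ U, u ≠ v ∧ (nbrs G U u).card ≤ 1 := by
  induction k using Nat.strong_induction_on with
  | _ k ih =>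
    intro U v hk hU hv hne
    obtain ⟨w, hw⟩ := exists_adj hU hv hne
    have hwU := mem_erase_of_mem_nbrs hw
    have hK := connSet_comp (G := G) hwU
    have hsub : comp G (U.erase v) w ⊆ U := comp_subset.trans (Finset.erase_subset _ _)
    -- Only the root w of the branch is adjacent to v, so an end of the branch other than w is still
    -- an end in U; if the branch is just w, then w is an end.
    by_cases h1 : ((comp G (U.erase v) w).erase w).Nonempty
    · have hlt : (comp G (U.erase v) w).card < k :=
        hk ▸ (Finset.card_le_card comp_subset).trans_lt (Finset.card_erase_lt_of_mem hv)
      obtain ⟨u, huK, huw, hu⟩ := ih _ hlt _ w rfl hK (mem_comp_self hwU) h1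
      refine ⟨u, hsub huK, Finset.ne_of_mem_erase (comp_subset huK), ?_⟩
      refine (Finset.card_le_card fun y hy => ?_).trans hu
      rcases Finset.mem_insert.1 (nbrs_subset_branch huK hy) with rfl | h
      · exact absurd (eq_of_mem_branch hG hw huK (mem_nbrs.1 hy).2.symm) huw
      · exact h
    · refine ⟨w, (mem_nbrs.1 hw).1, (mem_nbrs.1 hw).2.ne', ?_⟩
      refine (Finset.card_le_card (t := {v}) fun y hy => ?_).trans (Finset.card_singleton v).le
      rcases Finset.mem_insert.1 (nbrs_subset_branch (mem_comp_self hwU) hy) with h | h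
      · exact Finset.mem_singleton.2 h
      · exact absurd ⟨y, Finset.mem_erase.2 ⟨(mem_nbrs.1 h).2.ne', (mem_nbrs.1 h).1⟩⟩ h1

/-- Removing an end vertex from a connected set leaves a connected set. -/
theorem erase_end {U : Finset V} {u : V} (hU : ConnSet G U) (hu : u ∈ U)
    (hd : (nbrs G U u).card ≤ 1) (hne : (U.erase u).Nonempty) :
    ∃ w ∈ U.erase u, nbrs G U u = {w} ∧ ConnSet G (U.erase u) := by
  obtain ⟨w, hw⟩ := exists_adj hU hu hne
  have hs : nbrs G U u = {w} :=
    Finset.eq_singleton_iff_unique_mem.2 ⟨hw, fun y hy => Finset.card_le_one.1 hd y hy w hw⟩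
  have hwU := mem_erase_of_mem_nbrs hw
  have := biUnion_branch hU hu
  rw [hs, Finset.singleton_biUnion] at this
  exact ⟨w, hwU, hs, this ▸ connSet_comp hwU⟩

/-! ### Paths: counting recurrences and enumeration -/

/-- The number of independent sets of the path with `k` vertices. -/
def pathNum : ℕ → ℝ
  | 0 => 1
  | 1 => 2
  | k + 2 => pathNum (k + 1) + pathNum k

/-- The total size of the independent sets of the path with `k` vertices. -/
def pathTot : ℕ → ℝ
  | 0 => 0
  | 1 => 1
  | k + 2 => pathTot (k + 1) + pathTot k + pathNum k

theorem nbrs_mono {A B : Finset V} (h : A ⊆ B) (x : V) : nbrs G A x ⊆ nbrs G B x :=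
  Finset.filter_subset_filter _ h

theorem card_nbrs_erase_lt {U : Finset V} {u w : V} (h : u ∈ nbrs G U w) :
    (nbrs G (U.erase u) w).card < (nbrs G U w).card := by
  refine Finset.card_lt_card ⟨nbrs_mono (Finset.erase_subset _ _) w, fun hs => ?_⟩
  exact Finset.notMem_erase u U (mem_nbrs.1 (hs h)).1

/-- Removing an end vertex from a path leaves a path whose end is the former neighbour. -/
theorem erase_path_end {U : Finset V} {u : V} (hU : ConnSet G U) (hu : u ∈ U)
    (hd : (nbrs G U u).card ≤ 1) (h2 : ∀ x ∈ U, (nbrs G U x).card ≤ 2)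
    (hne : (U.erase u).Nonempty) :
    ∃ w ∈ U.erase u, nbrs G U u = {w} ∧ ConnSet G (U.erase u) ∧
      (nbrs G (U.erase u) w).card ≤ 1 ∧ ∀ x ∈ U.erase u, (nbrs G (U.erase u) x).card ≤ 2 := by
  obtain ⟨w, hw, hs, hc⟩ := erase_end hU hu hd hne
  have hwU := Finset.mem_of_mem_erase hw
  have huw : G.Adj u w := (mem_nbrs.1 (hs ▸ Finset.mem_singleton_self w)).2
  refine ⟨w, hw, hs, hc, ?_, fun x hx => (Finset.card_le_card (nbrs_mono (Finset.erase_subset _ _)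
    x)).trans (h2 x (Finset.mem_of_mem_erase hx))⟩
  have := card_nbrs_erase_lt (mem_nbrs.2 ⟨hu, huw.symm⟩ : u ∈ nbrs G U w)
  have := h2 w hwU
  omega

theorem remote_eq_of_nbrs_eq {U : Finset V} {u w : V} (hs : nbrs G U u = {w}) :
    remote G U u = (U.erase u).erase w := by
  ext x
  have : x ∈ nbrs G U u ↔ x = w := by rw [hs, Finset.mem_singleton]
  rw [mem_nbrs] at this
  simp only [remote, Finset.mem_filter, Finset.mem_erase]
  tauto

theorem num_singleton (u : V) : num G {u} = 2 ∧ tot G {u} = 1 := by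
  have h1 : remote G {u} u = ∅ := by simp [remote]
  have h2 : ({u} : Finset V).erase u = ∅ := by simp
  rw [num_recurrence (Finset.mem_singleton_self u), tot_recurrence (Finset.mem_singleton_self u),
    h1, h2, num_empty, tot_empty]
  norm_num

theorem num_tot_of_end (k : ℕ) : ∀ (U : Finset V) (u : V), U.card = k → ConnSet G U → u ∈ U →
    (nbrs G U u).card ≤ 1 → (∀ x ∈ U, (nbrs G U x).card ≤ 2) →
    num G U = pathNum k ∧ tot G U = pathTot k := by
  induction k using Nat.strong_induction_on with
  | _ k ih =>
    intro U u hk hU hu hd h2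
    by_cases hne : (U.erase u).Nonempty
    · obtain ⟨w, hw, hs, hc, hd', h2'⟩ := erase_path_end hU hu hd h2 hne
      have hk1 : (U.erase u).card + 1 = k := hk ▸ Finset.card_erase_add_one hu
      have hk2 := Finset.card_erase_add_one hw
      obtain ⟨j, rfl⟩ : ∃ j, k = j + 2 := ⟨((U.erase u).erase w).card, by omega⟩
      have e1 := ih (j + 1) (by omega) _ w (by omega) hc hw hd' h2'
      have e2 : num G ((U.erase u).erase w) = pathNum j ∧
          tot G ((U.erase u).erase w) = pathTot j := by
        by_cases hne' : ((U.erase u).erase w).Nonempty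
        · obtain ⟨w', hw', -, hc', hd'', h2''⟩ := erase_path_end hc hw hd' h2' hne'
          exact ih j (by omega) _ w' (by omega) hc' hw' hd'' h2''
        · rw [Finset.not_nonempty_iff_eq_empty] at hne'
          have hj : j = 0 := by rw [hne', Finset.card_empty] at hk2; omega
          rw [hne', hj, num_empty, tot_empty]
          exact ⟨rfl, rfl⟩
      rw [num_recurrence hu, tot_recurrence hu, remote_eq_of_nbrs_eq hs, e1.1, e1.2, e2.1, e2.2]
      exact ⟨rfl, rfl⟩
    · have hs : U = {u} := by
        rw [Finset.not_nonempty_iff_eq_empty] at hne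
        rw [← Finset.insert_erase hu, hne]; rfl
      obtain rfl : k = 1 := by rw [← hk, hs, Finset.card_singleton]
      rw [hs]
      exact num_singleton u

theorem exists_end (hG : NoCycle G) {U : Finset V} (hU : ConnSet G U) :
    ∃ u ∈ U, (nbrs G U u).card ≤ 1 := by
  obtain ⟨v, hv⟩ := hU.1
  by_cases hne : (U.erase v).Nonempty
  · obtain ⟨u, hu, -, h⟩ := exists_end_ne hG _ U v rfl hU hv hne
    exact ⟨u, hu, h⟩
  · refine ⟨v, hv, ?_⟩
    have : nbrs G U v = ∅ := Finset.eq_empty_of_forall_notMem fun w hw =>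
      hne ⟨w, mem_erase_of_mem_nbrs hw⟩
    simp [this]

theorem num_tot_of_path (hG : NoCycle G) {U : Finset V} (hU : ConnSet G U)
    (h2 : ∀ x ∈ U, (nbrs G U x).card ≤ 2) :
    num G U = pathNum U.card ∧ tot G U = pathTot U.card := by
  obtain ⟨u, hu, hd⟩ := exists_end hG hU
  exact num_tot_of_end _ U u rfl hU hu hd h2

/-- A path can be enumerated from an end vertex. -/
theorem exists_enum (k : ℕ) : ∀ (U : Finset V) (u : V), U.card = k + 1 → ConnSet G U → u ∈ U →
    (nbrs G U u).card ≤ 1 → (∀ x ∈ U, (nbrs G U x).card ≤ 2) →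
    ∃ g : ℕ → V, g 0 = u ∧ (∀ i ≤ k, ∀ j ≤ k, g i = g j → i = j) ∧ (∀ i ≤ k, g i ∈ U) ∧ (∀ x ∈ U, ∃ i ≤ k, g i = x) ∧
      ∀ i ≤ k, ∀ j ≤ k, (G.Adj (g i) (g j) ↔ i + 1 = j ∨ j + 1 = i) := by
  induction k with
  | zero =>
    intro U u hk hU hu hd h2
    obtain ⟨x, rfl⟩ := Finset.card_eq_one.1 hk
    obtain rfl := Finset.mem_singleton.1 hu
    refine ⟨fun _ => u, rfl, by omega, by simp, fun x hx => ⟨0, le_rfl, (Finset.mem_singleton.1 hx).symm⟩, ?_⟩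
    intro i hi j hj
    simp only [SimpleGraph.irrefl, false_iff]
    omega
  | succ k ih =>
    intro U u hk hU hu hd h2
    have hk1 : (U.erase u).card = k + 1 := by rw [Finset.card_erase_of_mem hu, hk]; rfl
    have hne : (U.erase u).Nonempty := Finset.card_pos.1 (by omega)
    obtain ⟨w, hw, hs, hc, hd', h2'⟩ := erase_path_end hU hu hd h2 hne
    obtain ⟨g, g0, ginj, gU, gsurj, gadj⟩ := ih _ w hk1 hc hw hd' h2'
    have uadj : ∀ i ≤ k, (G.Adj u (g i) ↔ i = 0) := by
      intro i hi
      have : g i ∈ nbrs G U u ↔ g i = w := by rw [hs, Finset.mem_singleton]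
      rw [mem_nbrs] at this
      have hgU := Finset.mem_of_mem_erase (gU i hi)
      constructor
      · intro h
        exact ginj i hi 0 (by omega) ((this.1 ⟨hgU, h⟩).trans g0.symm)
      · rintro rfl
        exact (this.2 g0).2
    refine ⟨fun i => if i = 0 then u else g (i - 1), by simp, ?_, ?_, ?_, ?_⟩
    · intro i hi j hj h
      rcases i with _ | i <;> rcases j with _ | j
      · rfl
      · exact absurd (gU j (by omega)) (by rw [← show u = g j from h]; exact Finset.notMem_erase u U)
      · exact absurd (gU i (by omega)) (by rw [show g i = u from h]; exact Finset.notMem_erase u U)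
      · rw [ginj i (by omega) j (by omega) h]
    · intro i hi
      by_cases h : i = 0
      · simp [h, hu]
      · simp only [h, if_false]
        exact Finset.mem_of_mem_erase (gU _ (by omega))
    · intro x hx
      by_cases h : x = u
      · exact ⟨0, by omega, by simp [h]⟩
      · obtain ⟨i, hi, rfl⟩ := gsurj x (Finset.mem_erase.2 ⟨h, hx⟩)
        exact ⟨i + 1, by omega, by simp⟩
    · intro i hi j hj
      rcases i with _ | i <;> rcases j with _ | j
      · simp
      · change G.Adj u (g j) ↔ _
        rw [uadj j (by omega)]; omega
      · change G.Adj (g i) u ↔ _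
        rw [G.adj_comm, uadj i (by omega)]; omega
      · change G.Adj (g i) (g j) ↔ _
        rw [gadj i (by omega) j (by omega)]; omega

/-! ### Numerical estimates for paths -/

/-- The slope `(5 - √5) / 10`. -/
noncomputable def slope : ℝ := (5 - √5) / 10

/-- Equivalently, (1 - 2a) / a is the golden ratio, the growth rate of `pathNum`. -/
theorem slope_quadratic : 5 * slope ^ 2 - 5 * slope + 1 = 0 := by
  have h : √5 ^ 2 = 5 := Real.sq_sqrt (by norm_num)
  rw [slope]; linear_combination h / 20

theorem slope_bounds : 0.276393 < slope ∧ slope < 0.276394 := by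
  have h1 : √5 < 2.23607 := by rw [Real.sqrt_lt' (by norm_num)]; norm_num
  have h2 : 2.23606 < √5 := by rw [Real.lt_sqrt (by norm_num)]; norm_num
  rw [slope]
  constructor <;> linarith

theorem intercept_eq : (79 * √5 - 165) / 70 = 23 / 7 - 79 / 7 * slope := by
  rw [slope]; ring

/-- The deviation of consecutive path counts from the dominant growth rate. -/
noncomputable def pathDev (k : ℕ) : ℝ := (1 - 2 * slope) * pathNum k - slope * pathNum (k + 1)

/-- The combination `pathDev` annihilates the dominant Fibonacci mode, leaving only the geometric
mode of ratio -a / (1 - 2a), of modulus below 1. -/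
theorem pathDev_succ (k : ℕ) : (1 - 2 * slope) * pathDev (k + 1) = -(slope * pathDev k) := by
  simp only [pathDev, pathNum]
  linear_combination pathNum (k + 1) * slope_quadratic

theorem abs_pathDev_le (k : ℕ) : |pathDev (k + 1)| ≤ 0.1 := by
  obtain ⟨h1, h2⟩ := slope_bounds
  induction k with
  -- The value at index 1 is 2 - 7a ≈ 0.065; at index 0 it is 1 - 4a ≈ -0.106, which is why the
  -- bound starts at 1.
  | zero => simp only [pathDev, pathNum]; rw [abs_le]; constructor <;> linarith
  | succ k ih =>
    have h3 : 0 < 1 - 2 * slope := by linarith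
    have := congrArg abs (pathDev_succ (k + 1))
    rw [abs_mul, abs_neg, abs_mul, abs_of_pos h3, abs_of_pos (by linarith : 0 < slope)] at this
    refine le_of_mul_le_mul_left (this.le.trans ?_) h3
    exact mul_le_mul (by linarith) ih (abs_nonneg _) h3.le

/-- The linearly corrected total size for a path. -/
noncomputable def pathExcess (k : ℕ) : ℝ := pathTot k - slope * k * pathNum k

theorem pathExcess_add_two (k : ℕ) :
    pathExcess (k + 2) = pathExcess (k + 1) + pathExcess k + pathDev k := by
  simp only [pathExcess, pathDev, pathNum, pathTot]; push_cast; ring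

/-- Both sides obey the Fibonacci recurrence up to a forcing `pathDev` of size at most 0.1. Two
margins of 0.1 add to 0.2, and losing 0.1 leaves the margin intact. Index 4 is excluded because
equality holds there. -/
theorem pathExcess_lower_aux (k : ℕ) :
    0.1 ≤ pathExcess (k + 5) - (5 / 4 - 4 * slope) * pathNum (k + 5) ∧
      0.1 ≤ pathExcess (k + 6) - (5 / 4 - 4 * slope) * pathNum (k + 6) := by
  obtain ⟨h1, h2⟩ := slope_bounds
  induction k with
  | zero => norm_num [pathExcess, pathNum, pathTot]; constructor <;> linarith
  | succ k ih =>
    refine ⟨ih.2, ?_⟩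
    have := (abs_le.1 (abs_pathDev_le (k + 4))).1
    rw [show k + 1 + 6 = (k + 5) + 2 by ring, pathExcess_add_two, pathNum]
    linarith [ih.1, ih.2]

theorem pathExcess_upper_aux (k : ℕ) :
    0.1 ≤ (23 / 7 - 79 / 7 * slope) * pathNum (k + 4) - pathExcess (k + 4) ∧
      0.1 ≤ (23 / 7 - 79 / 7 * slope) * pathNum (k + 5) - pathExcess (k + 5) := by
  obtain ⟨h1, h2⟩ := slope_bounds
  induction k with
  | zero => norm_num [pathExcess, pathNum, pathTot]; constructor <;> linarith
  | succ k ih =>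
    refine ⟨ih.2, ?_⟩
    have := (abs_le.1 (abs_pathDev_le (k + 3))).2
    rw [show k + 1 + 5 = (k + 4) + 2 by ring, pathExcess_add_two, pathNum]
    linarith [ih.1, ih.2]

theorem pathExcess_lower {k : ℕ} (h0 : k ≠ 0) (h2 : k ≠ 2) :
    (5 / 4 - 4 * slope) * pathNum k ≤ pathExcess k := by
  obtain ⟨h1, h2⟩ := slope_bounds
  rcases k with _ | _ | _ | _ | _ | k
  · contradiction
  · norm_num [pathExcess, pathNum, pathTot]; linarith
  · contradiction
  · norm_num [pathExcess, pathNum, pathTot]; linarith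
  · norm_num [pathExcess, pathNum, pathTot]; linarith
  · linarith [(pathExcess_lower_aux k).1]

theorem pathExcess_upper {k : ℕ} (h : 4 ≤ k) :
    pathExcess k < (23 / 7 - 79 / 7 * slope) * pathNum k := by
  obtain ⟨k, rfl⟩ := Nat.exists_eq_add_of_le' h
  linarith [(pathExcess_upper_aux k).1]

/-! ### Excess and its decomposition at a vertex -/

/-- The linearly corrected average size of the independent sets contained in `U`. -/
noncomputable def excess (G : SimpleGraph V) (U : Finset V) : ℝ := avg G U - slope * U.card

theorem excess_eq_of_path {U : Finset V}
    (h : num G U = pathNum U.card ∧ tot G U = pathTot U.card) :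
    excess G U * pathNum U.card = pathExcess U.card := by
  rw [excess, sub_mul, ← h.1, ← tot_eq_avg_mul, pathExcess, ← h.1, h.2]

theorem excess_union {A B : Finset V} (hd : Disjoint A B) (hs : Sep G A B) :
    excess G (A ∪ B) = excess G A + excess G B := by
  rw [excess, excess, excess, avg_union hd hs, Finset.card_union_of_disjoint hd]
  push_cast; ring

theorem remote_subset {U : Finset V} {v : V} : remote G U v ⊆ U.erase v :=
  Finset.filter_subset _ _

/-- Here q is the probability that v is chosen. Without v the branches are independent of one
another; with v they lose their roots, and the extra -a compensates for each lost root. -/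
theorem excess_eq_sum (hG : NoCycle G) {U : Finset V} {v : V} (hU : ConnSet G U) (hv : v ∈ U)
    {K : V → Finset V} (hK : K = comp G (U.erase v)) :
    ∃ q : ℝ, q * (1 + ∏ w ∈ nbrs G U v, num G ((K w).erase w) / num G (K w)) =
        ∏ w ∈ nbrs G U v, num G ((K w).erase w) / num G (K w) ∧
      excess G U = -slope + q + ∑ w ∈ nbrs G U v,
        ((1 - q) * excess G (K w) + q * (excess G ((K w).erase w) - slope)) := by
  subst hK
  set K := comp G (U.erase v) with hK
  have h1 := num_biUnion (nbrs G U v) K fun i hi j hj hij => disjoint_sep_branch hG hi hj hij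
  have h2 := num_biUnion (G := G) (nbrs G U v) (fun w => (K w).erase w) fun i hi j hj hij => by
    obtain ⟨hd, hs⟩ := disjoint_sep_branch hG hi hj hij
    exact ⟨hd.mono (Finset.erase_subset _ _) (Finset.erase_subset _ _), fun x hx y hy =>
      hs x (Finset.mem_of_mem_erase hx) y (Finset.mem_of_mem_erase hy)⟩
  have hc : (U.card : ℝ) = 1 + ∑ w ∈ nbrs G U v, ((K w).card : ℝ) := by
    rw [← Finset.card_erase_add_one hv, ← biUnion_branch hU hv, Finset.card_biUnion
      fun i hi j hj hij => (disjoint_sep_branch hG hi hj hij).1]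
    push_cast; ring
  rw [biUnion_branch hU hv] at h1
  rw [biUnion_branch_erase hG hU hv] at h2
  have hU0 := num_pos (G := G) U
  have hA0 := num_pos (G := G) (U.erase v)
  have hN := num_recurrence (G := G) hv
  have hT := tot_recurrence (G := G) hv
  refine ⟨num G (remote G U v) / num G U, ?_, ?_⟩
  · have hne := hN ▸ hU0.ne'
    rw [Finset.prod_div_distrib, ← h1.1, ← h2.1, hN]
    field_simp
  · have havg : avg G U = (1 - num G (remote G U v) / num G U) * avg G (U.erase v) +
        num G (remote G U v) / num G U * (1 + avg G (remote G U v)) := by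
      rw [avg, hT, tot_eq_avg_mul (U.erase v), tot_eq_avg_mul (remote G U v)]
      field_simp
      rw [hN]; ring
    have hterm : ∀ q : ℝ, ∀ w ∈ nbrs G U v,
        (1 - q) * excess G (K w) + q * (excess G ((K w).erase w) - slope) =
        (1 - q) * avg G (K w) + q * avg G ((K w).erase w) - slope * (K w).card := by
      intro q w hw
      have := Finset.card_erase_add_one
        (mem_comp_self (G := G) (mem_erase_of_mem_nbrs hw) : w ∈ K w)
      rw [excess, excess, ← this]
      push_cast; ring
    rw [Finset.sum_congr rfl (hterm _), Finset.sum_sub_distrib, Finset.sum_add_distrib,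
      ← Finset.mul_sum, ← Finset.mul_sum, ← Finset.mul_sum, ← h1.2, ← h2.2, excess, havg, hc]
    ring

theorem num_tot_of_card_le_three (hG : NoCycle G) {U : Finset V} (hU : ConnSet G U)
    (h : U.card ≤ 3) : num G U = pathNum U.card ∧ tot G U = pathTot U.card := by
  refine num_tot_of_path hG hU fun x hx => ?_
  have h1 := Finset.card_le_card fun y hy => mem_erase_of_mem_nbrs (G := G) (U := U) (v := x) hy
  have h2 := Finset.card_erase_add_one hx
  omega

theorem excess_card_one {U : Finset V} (h : U.card = 1) : excess G U = 1 / 2 - slope := by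
  obtain ⟨u, rfl⟩ := Finset.card_eq_one.1 h
  rw [excess, avg, (num_singleton u).1, (num_singleton u).2, h]; norm_num

theorem excess_card_two (hG : NoCycle G) {U : Finset V} (hU : ConnSet G U) (h : U.card = 2) :
    excess G U = 2 / 3 - 2 * slope := by
  have := num_tot_of_card_le_three hG hU (by omega)
  rw [excess, avg, this.1, this.2, h]; norm_num [pathNum, pathTot]; ring

theorem excess_card_three (hG : NoCycle G) {U : Finset V} (hU : ConnSet G U) (h : U.card = 3) :
    excess G U = 1 - 3 * slope := by
  have := num_tot_of_card_le_three hG hU (by omega)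
  rw [excess, avg, this.1, this.2, h]; norm_num [pathNum, pathTot]; ring

/-! ### Lower bounds by induction over branches -/

/-- Connected sets with fewer than `k` vertices, other than single edges, have excess at least
that of the path with four vertices. -/
def LowerBoundBelow (G : SimpleGraph V) (k : ℕ) : Prop :=
  ∀ U : Finset V, U.card < k → ConnSet G U → U.card ≠ 2 → 5 / 4 - 4 * slope ≤ excess G U

theorem excess_ge_of_nonempty (hG : NoCycle G) {k : ℕ} (H : LowerBoundBelow G k) (j : ℕ) :
    ∀ R : Finset V, R.card = j → j < k → R.Nonempty →
      2 / 3 - 2 * slope ≤ excess G R ∧ (¬ ConnSet G R → 2 * (2 / 3 - 2 * slope) ≤ excess G R) := by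
  obtain ⟨s1, s2⟩ := slope_bounds
  induction j using Nat.strong_induction_on with
  | _ j ih =>
    intro R hj hk hR
    obtain ⟨x, hx⟩ := hR
    have hC := connSet_comp (G := G) hx
    by_cases hc : ConnSet G R
    · refine ⟨?_, fun h => absurd hc h⟩
      by_cases h2 : R.card = 2
      · exact (excess_card_two hG hc h2).ge
      · linarith [H R (hj ▸ hk) hc h2]
    · have hne : (R \ comp G R x).Nonempty := by
        rw [Finset.sdiff_nonempty]
        exact fun h => hc (comp_subset.antisymm h ▸ hC)
      have hcard := Finset.card_sdiff_add_card_eq_card (comp_subset (G := G) (W := R) (x := x))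
      have h1 := hC.1.card_pos
      have h2 := hne.card_pos
      have e1 := (ih _ (by omega) (comp G R x) rfl (by omega) hC.1).1
      have e2 := (ih _ (by omega) (R \ comp G R x) rfl (by omega) hne).1
      have e3 := excess_union (G := G) (Finset.disjoint_sdiff (s := comp G R x) (t := R)) sep_comp
      rw [Finset.union_sdiff_of_subset comp_subset] at e3
      constructor
      · linarith
      · intro _; linarith

/-- The first alternative is the single edge. The second needs an upper bound on q for two small
branches: q ≤ 1/3 for a single vertex (p = 1/2), and q ≤ 3/8 for a three-vertex path rooted at an
end (p = 3/5). -/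
theorem branch_bound (hG : NoCycle G) {k : ℕ} (H : LowerBoundBelow G k) {K : Finset V} {w : V}
    (hK : ConnSet G K) (hk : K.card < k) (hw : w ∈ K) {p : ℝ}
    (hp : p = num G (K.erase w) / num G K) :
    1 / 2 ≤ p ∧ p ≤ 1 ∧ ((p = 2 / 3 ∧ ∀ q : ℝ,
        (1 - q) * excess G K + q * (excess G (K.erase w) - slope) = 2 / 3 - 2 * slope - q / 6) ∨
      ∀ q : ℝ, 0 ≤ q → q * (1 + p) ≤ p → 5 / 4 - 4 * slope - slope * q ≤
        (1 - q) * excess G K + q * (excess G (K.erase w) - slope)) := by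
  obtain ⟨s1, s2⟩ := slope_bounds
  have hN := num_recurrence (G := G) hw
  have hle := num_mono (G := G) (remote_subset (G := G) (U := K) (v := w))
  have hpos := num_pos (G := G) K
  have hc := Finset.card_erase_add_one hw
  have hp1 : 1 / 2 ≤ p := by rw [hp, div_le_div_iff₀ (by norm_num) hpos]; linarith
  have hp2 : p ≤ 1 := by
    rw [hp, div_le_one hpos]; exact num_mono (Finset.erase_subset _ _)
  refine ⟨hp1, hp2, ?_⟩
  by_cases c1 : K.card = 1
  · right
    intro q hq hqp
    have he : K.erase w = ∅ := Finset.card_eq_zero.1 (by omega)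
    obtain ⟨u, rfl⟩ := Finset.card_eq_one.1 c1
    rw [he, num_empty, (num_singleton u).1] at hp
    rw [he, excess_card_one c1, excess, avg_empty, Finset.card_empty]
    subst hp
    push_cast
    nlinarith
  by_cases c2 : K.card = 2
  · left
    have h1 : (K.erase w).card = 1 := by omega
    have h2 := (num_tot_of_card_le_three hG hK (by omega)).1
    constructor
    · obtain ⟨u, hu⟩ := Finset.card_eq_one.1 h1
      rw [hp, hu, (num_singleton u).1, h2, c2]; norm_num [pathNum]
    · intro q
      rw [excess_card_two hG hK c2, excess_card_one h1]; ring
  right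
  intro q hq hqp
  have hx := H K hk hK c2
  have hR : (K.erase w).Nonempty := Finset.card_pos.1 (by have := hK.1.card_pos; omega)
  have hq1 : q ≤ 1 := by nlinarith
  -- The bound for K minus its root can fail only if that remainder is a single edge, which makes K
  -- a three-vertex path rooted at an end.
  suffices h : 5 / 4 - 4 * slope ≤ excess G (K.erase w) ∨
      (excess G K = 1 - 3 * slope ∧ excess G (K.erase w) = 2 / 3 - 2 * slope ∧ p = 3 / 5) by
    rcases h with h | ⟨h1, h2, rfl⟩
    · nlinarith [mul_le_mul_of_nonneg_left hx (by linarith : 0 ≤ 1 - q),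
        mul_le_mul_of_nonneg_left h hq]
    · rw [h1, h2]; nlinarith
  by_cases hcR : ConnSet G (K.erase w)
  · by_cases c3 : (K.erase w).card = 2
    · right
      refine ⟨excess_card_three hG hK (by omega), excess_card_two hG hcR c3, ?_⟩
      rw [hp, (num_tot_of_card_le_three hG hK (by omega)).1,
        (num_tot_of_card_le_three hG hcR (by omega)).1, c3, show K.card = 3 by omega]
      norm_num [pathNum]
    · exact Or.inl (H _ (by omega) hcR c3)
  -- A disconnected remainder has excess at least 4/3 - 4a, already more than 5/4 - 4a.
  · left
    have := (excess_ge_of_nonempty hG H _ _ rfl (by omega) hR).2 hcR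
    linarith

/-- The numerical estimate for the contributions of the branches at a branching vertex. -/
theorem branch_sum_bound {ι : Type*} (D : Finset ι) (hD : 3 ≤ D.card) (p C : ι → ℝ) (q : ℝ)
    (hq : q * (1 + ∏ i ∈ D, p i) = ∏ i ∈ D, p i) (hp : ∀ i ∈ D, 1 / 2 ≤ p i ∧ p i ≤ 1)
    (hC : 0 ≤ q → ∀ i ∈ D, q * (1 + p i) ≤ p i → (p i = 2 / 3 ∧ C i = 2 / 3 - 2 * slope - q / 6) ∨
      5 / 4 - 4 * slope - slope * q ≤ C i) :
    slope + (23 / 7 - 79 / 7 * slope) ≤ q + ∑ i ∈ D, C i := by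
  obtain ⟨s1, s2⟩ := slope_bounds
  have hP0 : 0 < ∏ i ∈ D, p i := Finset.prod_pos fun i hi => by linarith [(hp i hi).1]
  have hP1 : ∀ E ⊆ D, ∏ i ∈ E, p i ≤ 1 := fun E hE =>
    Finset.prod_le_one (fun i hi => by linarith [(hp i (hE hi)).1]) fun i hi => (hp i (hE hi)).2
  have hq0 : 0 ≤ q := by
    by_contra h
    nlinarith
  have hq2 : q ≤ 1 / 2 := by nlinarith [hP1 D subset_rfl]
  have hC' : ∀ i ∈ D, (p i = 2 / 3 ∧ C i = 2 / 3 - 2 * slope - q / 6) ∨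
      5 / 4 - 4 * slope - slope * q ≤ C i := by
    intro i hi
    -- All factors are at most 1, so the product is at most each p i, and q / (1 - q) ≤ p i.
    refine hC hq0 i hi ?_
    have hle : ∏ i ∈ D, p i ≤ p i := by
      rw [← Finset.mul_prod_erase D p hi]
      exact mul_le_of_le_one_right (by linarith [(hp i hi).1]) (hP1 _ (Finset.erase_subset _ _))
    nlinarith
  have hsq : slope * q ≤ 0.276394 * q := mul_le_mul_of_nonneg_right s2.le hq0
  rcases hD.eq_or_lt with h3 | h4
  · obtain ⟨x, y, z, hxy, hxz, hyz, rfl⟩ := Finset.card_eq_three.1 h3.symm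
    have hsum : ∑ i ∈ ({x, y, z} : Finset ι), C i = C x + C y + C z := by
      rw [Finset.sum_insert (by simp [hxy, hxz]), Finset.sum_pair hyz, add_assoc]
    have hprod : ∏ i ∈ ({x, y, z} : Finset ι), p i = p x * p y * p z := by
      rw [Finset.prod_insert (by simp [hxy, hxz]), Finset.prod_pair hyz, mul_assoc]
    rw [hprod] at hq
    rw [hsum]
    have hlow : ∀ a b c : ℝ, 0 ≤ a → 0 ≤ b → 0 ≤ c → a ≤ p x → b ≤ p y → c ≤ p z →
        a * b * c * (1 - q) ≤ q := by
      intro a b c ha hb hc hax hby hcz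
      have : a * b * c ≤ p x * p y * p z :=
        mul_le_mul (mul_le_mul hax hby hb (ha.trans hax)) hcz hc
          (mul_nonneg (ha.trans hax) (hb.trans hby))
      nlinarith
    have hx := hp x (by simp)
    have hy := hp y (by simp)
    have hz := hp z (by simp)
    -- This serves the case of exactly one edge branch: the product is at least 2/3 · 1/2 · 1/2 =
    -- 1/6, so q ≥ 1/7. The resulting lower bound grows in q at rate 5/6 - 2a and at q = 1/7 equals
    -- a + b exactly; this is the case that fixes b.
    have hone : ∀ q : ℝ, 1 / 7 ≤ q → 0 ≤ (q - 1 / 7) * (5 / 6 - 2 * slope) := fun q h =>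
      mul_nonneg (by linarith) (by linarith)
    rcases hC' x (by simp) with ⟨px, cx⟩ | cx <;> rcases hC' y (by simp) with ⟨py, cy⟩ | cy <;>
      rcases hC' z (by simp) with ⟨pz, cz⟩ | cz
    · have := hlow (2 / 3) (2 / 3) (2 / 3) (by norm_num) (by norm_num) (by norm_num) px.ge py.ge pz.ge
      linarith
    · have := hlow (2 / 3) (2 / 3) (1 / 2) (by norm_num) (by norm_num) (by norm_num) px.ge py.ge hz.1
      linarith
    · have := hlow (2 / 3) (1 / 2) (2 / 3) (by norm_num) (by norm_num) (by norm_num) px.ge hy.1 pz.ge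
      linarith
    · have := hlow (2 / 3) (1 / 2) (1 / 2) (by norm_num) (by norm_num) (by norm_num) px.ge hy.1 hz.1
      linarith [hone q (by linarith)]
    · have := hlow (1 / 2) (2 / 3) (2 / 3) (by norm_num) (by norm_num) (by norm_num) hx.1 py.ge pz.ge
      linarith
    · have := hlow (1 / 2) (2 / 3) (1 / 2) (by norm_num) (by norm_num) (by norm_num) hx.1 py.ge hz.1
      linarith [hone q (by linarith)]
    · have := hlow (1 / 2) (1 / 2) (2 / 3) (by norm_num) (by norm_num) (by norm_num) hx.1 hy.1 pz.ge
      linarith [hone q (by linarith)]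
    · have := hlow (1 / 2) (1 / 2) (1 / 2) (by norm_num) (by norm_num) (by norm_num) hx.1 hy.1 hz.1
      linarith
  -- One linear bound lying below both alternatives for 0 ≤ q ≤ 1/2. It stays positive there, so
  -- branches beyond the fourth only help.
  · have hl : ∀ i ∈ D, 0.1138 - 0.2153 * q ≤ C i := by
      intro i hi
      rcases hC' i hi with ⟨-, h⟩ | h <;> linarith
    have h5 : (4 : ℝ) ≤ D.card := by exact_mod_cast h4
    have h6 := Finset.card_nsmul_le_sum D C _ hl
    rw [nsmul_eq_mul] at h6
    nlinarith

theorem excess_lower_of_branching (hG : NoCycle G) {U : Finset V} {v : V}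
    (H : LowerBoundBelow G U.card) (hU : ConnSet G U) (hv : v ∈ U)
    (h3 : 3 ≤ (nbrs G U v).card) : 23 / 7 - 79 / 7 * slope ≤ excess G U := by
  obtain ⟨q, hq, he⟩ := excess_eq_sum hG hU hv rfl
  have key := fun w (hw : w ∈ nbrs G U v) =>
    branch_bound hG H (connSet_comp (G := G) (mem_erase_of_mem_nbrs hw))
      ((Finset.card_le_card comp_subset).trans_lt (Finset.card_erase_lt_of_mem hv))
      (mem_comp_self (mem_erase_of_mem_nbrs hw)) rfl
  have := branch_sum_bound (nbrs G U v) h3 _ (fun w => (1 - q) * excess G (comp G (U.erase v) w) +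
    q * (excess G ((comp G (U.erase v) w).erase w) - slope)) q hq
    (fun w hw => ⟨(key w hw).1, (key w hw).2.1⟩)
    fun hq0 w hw hqp => (key w hw).2.2.imp (fun h => ⟨h.1, h.2 q⟩) fun h => h q hq0 hqp
  rw [he]; linarith

theorem lowerBoundBelow (hG : NoCycle G) (k : ℕ) : LowerBoundBelow G k := by
  induction k with
  | zero => exact fun U h => absurd h (Nat.not_lt_zero _)
  | succ k ih =>
    intro U hk hU h2
    have ih' : LowerBoundBelow G U.card := fun W hW => ih W (by omega)
    by_cases h : ∀ x ∈ U, (nbrs G U x).card ≤ 2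
    · have hp := num_tot_of_path hG hU h
      have h1 := excess_eq_of_path hp
      have h3 := pathExcess_lower hU.1.card_pos.ne' h2
      rw [← h1] at h3
      exact le_of_mul_le_mul_right h3 (hp.1 ▸ num_pos U)
    · push Not at h
      obtain ⟨x, hx, h⟩ := h
      obtain ⟨s1, s2⟩ := slope_bounds
      linarith [excess_lower_of_branching hG ih' hU hx h]

/-! ### Trees and path graphs in terms of connected sets -/

theorem connSet_univ [Fintype V] (h : G.Connected) : ConnSet G Finset.univ := by
  have := h.nonempty
  refine ⟨Finset.univ_nonempty, fun K _ hne hs => Finset.eq_univ_iff_forall.2 fun y => ?_⟩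
  obtain ⟨x, hx⟩ := hne
  obtain ⟨p⟩ := h.preconnected x y
  induction p with
  | nil => exact hx
  | cons hadj _ ih =>
    refine ih ?_
    by_contra hc
    exact hs _ hx _ (by simpa using hc) hadj

theorem exists_walk_of_connSet {K : Finset V} (hK : ConnSet G K) {x y : V} (hx : x ∈ K)
    (hy : y ∈ K) : ∃ p : G.Walk x y, ∀ z ∈ p.support, z ∈ K := by
  have h := hK.2 (K.filter fun y => ∃ p : G.Walk x y, ∀ z ∈ p.support, z ∈ K)
    (Finset.filter_subset _ _) ⟨x, Finset.mem_filter.2 ⟨hx, .nil, by simpa using hx⟩⟩ ?_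
  · rw [← h] at hy
    exact (Finset.mem_filter.1 hy).2
  · intro a ha b hb hab
    obtain ⟨haK, p, hp⟩ := Finset.mem_filter.1 ha
    obtain ⟨hbK, hb⟩ := Finset.mem_sdiff.1 hb
    refine hb (Finset.mem_filter.2 ⟨hbK, p.concat hab, fun z hz => ?_⟩)
    rw [SimpleGraph.Walk.support_concat] at hz
    simp only [List.mem_append, List.mem_singleton] at hz
    rcases hz with hz | rfl
    exacts [hp z hz, hbK]

/-- Two neighbours of v in K would be joined by a path inside K and by the path through v, against
uniqueness of paths. -/
theorem noCycle_of_isAcyclic (h : G.IsAcyclic) : NoCycle G := by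
  intro K v w w' hK hv hw hw' hvw hvw'
  by_contra hne
  obtain ⟨p, hp⟩ := exists_walk_of_connSet hK hw hw'
  have hq : (SimpleGraph.Walk.cons hvw.symm (.cons hvw' .nil)).IsPath := by
    simp [SimpleGraph.Walk.cons_isPath_iff, hvw.ne', hvw'.ne, hne]
  have e := (h.subsingleton_path w w').elim p.toPath ⟨_, hq⟩
  refine hv (hp v (p.support_toPath_subset_support ?_))
  rw [e]
  simp

theorem pathGraph_isAcyclic (n : ℕ) : (SimpleGraph.pathGraph n).IsAcyclic := by
  rw [SimpleGraph.isAcyclic_iff_forall_adj_isBridge]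
  have key : ∀ u v : Fin n, u.val + 1 = v.val →
      (SimpleGraph.pathGraph n).IsBridge s(u, v) := by
    intro u v huv
    rw [SimpleGraph.isBridge_iff]
    rintro ⟨p⟩
    -- Once the edge from u to u + 1 is deleted, no walk leaves the initial segment up to u, so
    -- every edge is a bridge.
    suffices h : ∀ x y : Fin n, ((SimpleGraph.pathGraph n).deleteEdges {s(u, v)}).Walk x y →
        x ≤ u → y ≤ u by
      have := h u v p le_rfl
      rw [Fin.le_def] at this; omega
    intro x y p
    induction p with
    | nil => exact id
    | @cons a b c hab _ ih =>
      intro ha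
      refine ih ?_
      rw [SimpleGraph.deleteEdges_adj, SimpleGraph.pathGraph_adj] at hab
      obtain ⟨h1, h2⟩ := hab
      by_contra hb
      refine h2 ?_
      rw [Fin.le_def] at ha hb
      have e1 : a = u := Fin.ext (by omega)
      have e2 : b = v := Fin.ext (by omega)
      rw [e1, e2]; rfl
  intro u v huv
  rcases SimpleGraph.pathGraph_adj.1 huv with h | h
  · exact key u v h
  · rw [Sym2.eq_swap]; exact key v u h

theorem pathGraph_isTree {n : ℕ} (hn : n ≠ 0) : (SimpleGraph.pathGraph n).IsTree := by
  obtain ⟨k, rfl⟩ := Nat.exists_eq_succ_of_ne_zero hn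
  exact ⟨SimpleGraph.pathGraph_connected k, pathGraph_isAcyclic _⟩

theorem card_nbrs_pathGraph_le {n : ℕ} (x : Fin n) :
    (nbrs (SimpleGraph.pathGraph n) Finset.univ x).card ≤ 2 := by
  have h : (nbrs (SimpleGraph.pathGraph n) Finset.univ x).image Fin.val ⊆
      {x.val + 1, x.val - 1} := by
    intro i hi
    obtain ⟨y, hy, rfl⟩ := Finset.mem_image.1 hi
    have := SimpleGraph.pathGraph_adj.1 (mem_nbrs.1 hy).2
    simp only [Finset.mem_insert, Finset.mem_singleton]
    omega
  rw [← Finset.card_image_of_injective _ Fin.val_injective]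
  exact (Finset.card_le_card h).trans Finset.card_le_two

theorem card_nbrs_le_of_iso [Fintype V] {n : ℕ} (e : G ≃g SimpleGraph.pathGraph n) (x : V) :
    (nbrs G Finset.univ x).card ≤ 2 := by
  refine le_trans ?_ (card_nbrs_pathGraph_le (e x))
  refine Finset.card_le_card_of_injOn e (fun y hy => ?_) e.injective.injOn
  exact mem_nbrs.2 ⟨Finset.mem_univ _, e.map_adj_iff.2 (mem_nbrs.1 hy).2⟩

theorem nonempty_iso_pathGraph [Fintype V] (h : G.IsTree)
    (h2 : ∀ x, (nbrs G Finset.univ x).card ≤ 2) {n : ℕ} (hn : Fintype.card V = n) :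
    Nonempty (G ≃g SimpleGraph.pathGraph n) := by
  have hU := connSet_univ h.connected
  obtain ⟨u, hu, hd⟩ := exists_end (noCycle_of_isAcyclic h.isAcyclic) hU
  obtain ⟨k, rfl⟩ : ∃ k, n = k + 1 :=
    Nat.exists_eq_succ_of_ne_zero (hn ▸ (Fintype.card_pos_iff.2 ⟨u⟩).ne')
  obtain ⟨g, -, ginj, -, gsurj, gadj⟩ := exists_enum k _ u hn hU hu hd fun x _ => h2 x
  have hb : Function.Bijective fun i : Fin (k + 1) => g i := by
    refine ⟨fun i j hij => Fin.ext (ginj i (by omega) j (by omega) hij), fun x => ?_⟩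
    obtain ⟨i, hi, rfl⟩ := gsurj x (Finset.mem_univ x)
    exact ⟨⟨i, by omega⟩, rfl⟩
  let e : SimpleGraph.pathGraph (k + 1) ≃g G := ⟨Equiv.ofBijective _ hb, fun {i j} => by
    rw [SimpleGraph.pathGraph_adj]
    exact gadj i (by omega) j (by omega)⟩
  exact ⟨e.symm⟩

theorem avgIndepSize_of_path [Fintype V] (h : G.IsTree)
    (h2 : ∀ x, (nbrs G Finset.univ x).card ≤ 2) :
    avgIndepSize G = pathTot (Fintype.card V) / pathNum (Fintype.card V) := by
  have := num_tot_of_path (noCycle_of_isAcyclic h.isAcyclic) (connSet_univ h.connected)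
    fun x _ => h2 x
  rw [avgIndepSize_eq, avg, this.1, this.2, Finset.card_univ]

theorem avgIndepSize_pathGraph {n : ℕ} (hn : n ≠ 0) :
    avgIndepSize (SimpleGraph.pathGraph n) = pathTot n / pathNum n := by
  rw [avgIndepSize_of_path (pathGraph_isTree hn) card_nbrs_pathGraph_le, Fintype.card_fin]

theorem pathNum_pos (k : ℕ) : 0 < pathNum k := by
  induction k using Nat.twoStepInduction with
  | zero => norm_num [pathNum]
  | one => norm_num [pathNum]
  | more k h1 h2 => rw [pathNum]; linarith

theorem avgIndepSize_pathGraph_lt {n : ℕ} (hn : 4 ≤ n) :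
    avgIndepSize (SimpleGraph.pathGraph n) < slope * n + (23 / 7 - 79 / 7 * slope) := by
  rw [avgIndepSize_pathGraph (by omega), div_lt_iff₀ (pathNum_pos n)]
  have := pathExcess_upper hn
  rw [pathExcess] at this
  linarith

theorem avgIndepSize_lower_of_branching [Fintype V] (h : G.IsTree) {x : V}
    (hx : 3 ≤ (nbrs G Finset.univ x).card) :
    slope * Fintype.card V + (23 / 7 - 79 / 7 * slope) ≤ avgIndepSize G := by
  have hG := noCycle_of_isAcyclic h.isAcyclic
  have := excess_lower_of_branching hG (lowerBoundBelow hG _) (connSet_univ h.connected)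
    (Finset.mem_univ x) hx
  rw [excess, Finset.card_univ] at this
  rw [avgIndepSize_eq]; linarith

end IndepTree

theorem mainTheorem6 {V : Type*} [Fintype V] (n : ℕ) (hn : Fintype.card V = n)
    (T : SimpleGraph V) (hT : T.IsTree) :
    (¬ Nonempty (T ≃g SimpleGraph.pathGraph n) →
      (5 - √5) / 10 * (n : ℝ) + (79 * √5 - 165) / 70 ≤ avgIndepSize T) ∧
    (SimpleGraph.pathGraph n).IsTree ∧
    avgIndepSize (SimpleGraph.pathGraph n) ≤ avgIndepSize T ∧
    (avgIndepSize T = avgIndepSize (SimpleGraph.pathGraph n) ↔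
      Nonempty (T ≃g SimpleGraph.pathGraph n)) := by
  classical
  have hne := hT.connected.nonempty
  have hn0 : n ≠ 0 := hn ▸ Fintype.card_ne_zero
  rw [IndepTree.intercept_eq, ← IndepTree.slope]
  by_cases h2 : ∀ x, (IndepTree.nbrs T Finset.univ x).card ≤ 2
  · have hiso := IndepTree.nonempty_iso_pathGraph hT h2 hn
    have he : avgIndepSize T = avgIndepSize (SimpleGraph.pathGraph n) := by
      rw [IndepTree.avgIndepSize_of_path hT h2, IndepTree.avgIndepSize_pathGraph hn0, hn]
    exact ⟨fun h => absurd hiso h, IndepTree.pathGraph_isTree hn0, he.ge, fun _ => hiso, fun _ => he⟩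
  · push Not at h2
    obtain ⟨x, hx⟩ := h2
    have hb := IndepTree.avgIndepSize_lower_of_branching hT hx
    -- Three neighbours and x itself; four vertices are exactly what the strict upper bound for
    -- paths requires.
    have hn4 : 4 ≤ n := by
      have h1 := Finset.card_le_card fun y hy =>
        IndepTree.mem_erase_of_mem_nbrs (G := T) (U := Finset.univ) (v := x) hy
      rw [Finset.card_erase_of_mem (Finset.mem_univ x), Finset.card_univ, hn] at h1
      omega
    have hlt := IndepTree.avgIndepSize_pathGraph_lt hn4
    rw [hn] at hb
    refine ⟨fun _ => hb, IndepTree.pathGraph_isTree hn0, (hlt.trans_le hb).le,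
      fun h => absurd h (hlt.trans_le hb).ne', fun ⟨e⟩ => ?_⟩
    exact absurd (IndepTree.card_nbrs_le_of_iso e x) (by omega)
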